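/- For $p\in(0,1]$ and $x\in(0,\pi/2)$ put $f_p(x)=\ln\frac{\sin x}{x}-\frac{1}{3p^2}\ln\cos(px)$. The equation $\ln\frac{2}{\pi}=\frac{1}{3p^2}\ln\cos\frac{p\pi}{2}$ has a unique root $p_1$ in $(0,1]$, and $p_1=0.45346830977067\ldots$ (that is, $0.45346830977067\le p_1<0.45346830977068$). For every $p\in(0,1]$, the inequality $$\frac{\sin x}{x}>(\cos px)^{1/(3p^2)}$$ holds for all $x\in(0,\pi/2)$ if and only if $p\in[p_1,1]$. Moreover, $f_{p_1}$ has a unique critical point $x_0$ in $(0,\pi/2)$, and with $\beta=\exp(f_{p_1}(x_0))$, where $\beta\approx1.0002$ (precisely, $|\beta-1.0002|<5\cdot10^{-5}$), we have for all $x\in(0,\pi/2)$ $$(\cos p_1x)^{1/(3p_1^2)}<\frac{\sin x}{x}\le\beta\,(\cos p_1x)^{1/(3p_1^2)},$$ with equality on the right if and only if $x=x_0$. The constants $1$ and $\beta$ are best possible: $1$ is the greatest $a\in\mathbb{R}$ such that $a\,(\cos p_1x)^{1/(3p_1^2)}<\frac{\sin x}{x}$ for all $x\in(0,\pi/2)$,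 and $\beta$ is the least $b\in\mathbb{R}$ such that $\frac{\sin x}{x}\le b\,(\cos p_1x)^{1/(3p_1^2)}$ for all $x\in(0,\pi/2)$. -/

import Mathlib

/-- `f_p(x) = ln (sin x / x) - (1 / (3 p ^ 2)) ln (cos (p x))`, used for `0 < p ≤ 1` and
`0 < x < π / 2`, where both logarithms have positive arguments. -/
noncomputable def logDefect (p x : ℝ) : ℝ :=
  Real.log (Real.sin x / x) - 1 / (3 * p ^ 2) * Real.log (Real.cos (p * x))

/-- The comparison function `(cos (p x)) ^ (1 / (3 p ^ 2))`; the base is positive for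
`0 < p ≤ 1` and `0 < x < π / 2`. -/
noncomputable def cosPow (p x : ℝ) : ℝ :=
  Real.cos (p * x) ^ (1 / (3 * p ^ 2))

/-- `p ∈ (0, 1]` is a root of `ln (2 / π) = (1 / (3 p ^ 2)) ln (cos (p π / 2))`.
At `p = 1`, where the cosine is `0`, the right-hand side evaluates to `0` by the convention
`Real.log 0 = 0`, and since `ln (2 / π) ≠ 0` this endpoint is not a root. -/
def IsEndpointRoot (p : ℝ) : Prop :=
  p ∈ Set.Ioc (0 : ℝ) 1 ∧
    Real.log (2 / Real.pi) = 1 / (3 * p ^ 2) * Real.log (Real.cos (p * Real.pi / 2))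

/-- `x ∈ (0, π / 2)` is a critical point of `f_p`. -/
def IsCriticalPoint (p x : ℝ) : Prop :=
  x ∈ Set.Ioo (0 : ℝ) (Real.pi / 2) ∧ HasDerivAt (logDefect p) 0 x

/-!
Expanding `-log (sin x / x) = ∑ a_k x ^ (2 k)` and `-log (cos y) = ∑ (4 ^ k - 1) a_k y ^ (2 k)`
shows that `f_p (x) = ∑ a_k ((4 ^ k - 1) p ^ (2 k - 2) / 3 - 1) x ^ (2 k)`. The quadratic
coefficient vanishes, and for `p` close to the endpoint root the quartic one is positive and all
others are negative. Hence `f_p' (x) / x ^ 3` is strictly decreasing: `f_p` increases up to a unique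
critical point and decreases after it. Since `f_p` vanishes at `0`, and at `π / 2` when `p` is the
endpoint root, it is positive in between.

The monotonicity of `f_p' (x) / x ^ 3` is proved without power series. The Mittag-Leffler expansion
of the cotangent, together with `tan y = cot y - 2 cot (2 y)`, writes this quotient as a series of
elementary fractions (`hasSum_derivTerm`), each of which is strictly decreasing as soon as
`64 p ^ 4 < 3` (`derivTerm_lt_of_lt`).

The dependence on `p` is governed by the monotonicity of `-log (cos y) / y ^ 2`
(`strictMonoOn_neg_log_cos_div_sq`), which makes `f_p (x)` strictly increasing in `p`. This gives
the uniqueness of the endpoint root and transfers positivity from that root to all larger parameters;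
for smaller ones `f_p (π / 2) < 0`, so the inequality fails near `π / 2`.

The digits of the root come from the signs of `f_p (π / 2)` at the two ends of the stated interval,
computed with Taylor enclosures. For the size of the maximum it suffices to know `f_p` and `f_p'`
at the single point `13 / 10`, because the monotone quotient bounds the slope to the right of it
(`logDefect_sub_le`).
-/

/-! ### Taylor enclosures for sine, cosine and the logarithm -/

/-- The first `2 n` terms of the series of `exp (i x)` split into the Taylor polynomials of the cosine
and the sine. -/
theorem sum_range_exp_mul_I (x : ℝ) (n : ℕ) :
    ∑ m ∈ Finset.range (2 * n), ((x : ℂ) * Complex.I) ^ m / (m.factorial : ℂ) =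
      ((∑ k ∈ Finset.range n, (-1) ^ k * x ^ (2 * k) / ((2 * k).factorial : ℝ) : ℝ) : ℂ) +
      ((∑ k ∈ Finset.range n,
        (-1) ^ k * x ^ (2 * k + 1) / ((2 * k + 1).factorial : ℝ) : ℝ) : ℂ) * Complex.I := by
  induction n with
  | zero => simp
  | succ n ih =>
    have hI : Complex.I ^ (2 * n) = (-1) ^ n := by rw [pow_mul, Complex.I_sq]
    rw [show 2 * (n + 1) = 2 * n + 1 + 1 by ring, Finset.sum_range_succ, Finset.sum_range_succ, ih,
      Finset.sum_range_succ, Finset.sum_range_succ, mul_pow, mul_pow, pow_succ Complex.I, hI]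
    push_cast
    ring

theorem norm_exp_mul_I_sub_le (x : ℝ) (n : ℕ) (hx : |x| / (2 * n + 1) ≤ 1 / 2) :
    ‖Complex.exp (x * Complex.I) -
      ∑ m ∈ Finset.range (2 * n), ((x : ℂ) * Complex.I) ^ m / (m.factorial : ℂ)‖ ≤
      |x| ^ (2 * n) / ((2 * n).factorial : ℝ) * 2 := by
  have h := Complex.exp_bound' (x := (x : ℂ) * Complex.I) (n := 2 * n)
    (by simpa using hx)
  simpa using h

/-- Taylor enclosure of the cosine, the real part of the one for `exp (i x)`. -/
theorem abs_cos_sub_taylor_le (x : ℝ) (n : ℕ) (hx : |x| / (2 * n + 1) ≤ 1 / 2) :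
    |Real.cos x - ∑ k ∈ Finset.range n, (-1) ^ k * x ^ (2 * k) / ((2 * k).factorial : ℝ)| ≤
      |x| ^ (2 * n) / ((2 * n).factorial : ℝ) * 2 := by
  refine le_trans ?_ (norm_exp_mul_I_sub_le x n hx)
  refine le_trans (le_of_eq ?_) (Complex.abs_re_le_norm _)
  rw [sum_range_exp_mul_I, Complex.sub_re, Complex.exp_ofReal_mul_I_re]
  simp only [Complex.add_re, Complex.ofReal_re, Complex.re_ofReal_mul, Complex.I_re, mul_zero,
    add_zero]

/-- Taylor enclosure of the sine, the imaginary part of the one for `exp (i x)`. -/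
theorem abs_sin_sub_taylor_le (x : ℝ) (n : ℕ) (hx : |x| / (2 * n + 1) ≤ 1 / 2) :
    |Real.sin x -
      ∑ k ∈ Finset.range n, (-1) ^ k * x ^ (2 * k + 1) / ((2 * k + 1).factorial : ℝ)| ≤
      |x| ^ (2 * n) / ((2 * n).factorial : ℝ) * 2 := by
  refine le_trans ?_ (norm_exp_mul_I_sub_le x n hx)
  refine le_trans (le_of_eq ?_) (Complex.abs_im_le_norm _)
  rw [sum_range_exp_mul_I, Complex.sub_im, Complex.exp_ofReal_mul_I_im]
  simp only [Complex.add_im, Complex.ofReal_im, Complex.im_ofReal_mul, Complex.I_im, mul_one,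
    zero_add]

/-- A lower bound `-q` for `log x` amounts to `1 ≤ x * exp q`, which a partial sum of the exponential
series certifies. -/
theorem neg_le_log_of_one_le_mul_sum {x q : ℝ} (hx : 0 < x) (hq : 0 ≤ q) (n : ℕ)
    (h : 1 ≤ x * ∑ i ∈ Finset.range n, q ^ i / (i.factorial : ℝ)) : -q ≤ Real.log x := by
  have h1 := Real.sum_le_exp_of_nonneg hq n
  rw [Real.le_log_iff_exp_le hx, Real.exp_neg, inv_le_iff_one_le_mul₀ (Real.exp_pos q)]
  exact h.trans (mul_le_mul_of_nonneg_left h1 hx.le)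

/-- An upper bound `-q` for `log x` amounts to `x * exp q ≤ 1`; the last summand bounds the tail of
the exponential series. -/
theorem log_le_neg_of_mul_sum_le_one {x q : ℝ} (hx : 0 < x) (hq : 0 ≤ q) (hq1 : q ≤ 1) {n : ℕ}
    (hn : 0 < n)
    (h : x * ((∑ i ∈ Finset.range n, q ^ i / (i.factorial : ℝ)) +
      q ^ n * (n + 1) / (n.factorial * n)) ≤ 1) : Real.log x ≤ -q := by
  have h1 := Real.exp_bound' hq hq1 hn
  rw [Real.log_le_iff_le_exp hx, Real.exp_neg, le_inv_comm₀ hx (Real.exp_pos q),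
    inv_eq_one_div, le_div_iff₀ hx, mul_comm]
  exact (mul_le_mul_of_nonneg_left h1 hx.le).trans h

/-! ### Monotonicity in the parameter -/

theorem cos_parameter_mul_pos {p x : ℝ} (hp : 0 < p) (hp1 : p ≤ 1) (hx : 0 < x)
    (hx2 : x < Real.pi / 2) : 0 < Real.cos (p * x) := by
  apply Real.cos_pos_of_mem_Ioo
  constructor <;> nlinarith [Real.pi_pos, mul_pos hp hx]

/-- The numerator of the derivative of `-log (cos y) / y ^ 2`. Its own derivative is
`(y - sin y cos y) / cos² y > 0`. -/
theorem mul_tan_add_two_log_cos_pos {y : ℝ} (hy : 0 < y) (hy2 : y < Real.pi / 2) :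
    0 < y * Real.tan y + 2 * Real.log (Real.cos y) := by
  have hc : ∀ z ∈ Set.Ico (0 : ℝ) (Real.pi / 2), 0 < Real.cos z := fun z hz =>
    Real.cos_pos_of_mem_Ioo ⟨by linarith [hz.1, Real.pi_pos], hz.2⟩
  have hd : ∀ z ∈ Set.Ico (0 : ℝ) (Real.pi / 2),
      HasDerivAt (fun z => z * Real.tan z + 2 * Real.log (Real.cos z))
        ((z - Real.sin z * Real.cos z) / Real.cos z ^ 2) z := by
    intro z hz
    have hcz := (hc z hz).ne'
    refine (((hasDerivAt_id z).mul (Real.hasDerivAt_tan hcz)).add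
      (((Real.hasDerivAt_cos z).log hcz).const_mul 2)).congr_deriv ?_
    simp only [id, Real.tan_eq_sin_div_cos]
    field_simp
    ring
  have hmono : StrictMonoOn (fun z => z * Real.tan z + 2 * Real.log (Real.cos z))
      (Set.Ico (0 : ℝ) (Real.pi / 2)) := by
    apply strictMonoOn_of_deriv_pos (convex_Ico _ _)
      (fun z hz => (hd z hz).continuousAt.continuousWithinAt)
    intro z hz
    rw [interior_Ico] at hz
    have hz' : z ∈ Set.Ico (0 : ℝ) (Real.pi / 2) := ⟨hz.1.le, hz.2⟩
    rw [(hd z hz').deriv]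
    have h1 := hc z hz'
    have h2 := Real.sin_lt hz.1
    have h3 := Real.cos_le_one z
    have h4 : 0 < Real.sin z :=
      Real.sin_pos_of_pos_of_lt_pi hz.1 (by linarith [hz.2, Real.pi_pos])
    apply div_pos _ (by positivity)
    nlinarith
  have := hmono ⟨le_rfl, by linarith⟩ ⟨hy.le, hy2⟩ hy
  simpa using this

theorem strictMonoOn_neg_log_cos_div_sq :
    StrictMonoOn (fun y => -Real.log (Real.cos y) / y ^ 2) (Set.Ioo (0 : ℝ) (Real.pi / 2)) := by
  have hd : ∀ y ∈ Set.Ioo (0 : ℝ) (Real.pi / 2),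
      HasDerivAt (fun y => -Real.log (Real.cos y) / y ^ 2)
        ((y * Real.tan y + 2 * Real.log (Real.cos y)) / y ^ 3) y := by
    intro y hy
    have hc : Real.cos y ≠ 0 :=
      (Real.cos_pos_of_mem_Ioo ⟨by linarith [hy.1, Real.pi_pos], hy.2⟩).ne'
    have hy0 : y ≠ 0 := hy.1.ne'
    refine ((((Real.hasDerivAt_cos y).log hc).neg).div (hasDerivAt_pow 2 y)
      (pow_ne_zero 2 hy0)).congr_deriv ?_
    simp only [Real.tan_eq_sin_div_cos, Pi.neg_apply]
    field_simp
    ring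
  apply strictMonoOn_of_deriv_pos (convex_Ioo _ _)
    (fun y hy => (hd y hy).continuousAt.continuousWithinAt)
  intro y hy
  rw [interior_Ioo] at hy
  rw [(hd y hy).deriv]
  exact div_pos (mul_tan_add_two_log_cos_pos hy.1 hy.2) (pow_pos hy.1 3)

theorem log_cos_mul_div_strictAnti {p q x : ℝ} (hp : 0 < p) (hpq : p < q) (hx : 0 < x)
    (hqx : q * x < Real.pi / 2) :
    1 / (3 * q ^ 2) * Real.log (Real.cos (q * x)) <
      1 / (3 * p ^ 2) * Real.log (Real.cos (p * x)) := by
  have hlt : p * x < q * x := mul_lt_mul_of_pos_right hpq hx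
  have hq : 0 < q := hp.trans hpq
  have h := strictMonoOn_neg_log_cos_div_sq ⟨mul_pos hp hx, hlt.trans hqx⟩
    ⟨mul_pos hq hx, hqx⟩ hlt
  have key : ∀ r : ℝ, 0 < r → 1 / (3 * r ^ 2) * Real.log (Real.cos (r * x)) =
      -(x ^ 2 / 3) * (-Real.log (Real.cos (r * x)) / (r * x) ^ 2) := by
    intro r hr
    field_simp
  rw [key p hp, key q hq]
  simp only at h
  nlinarith [mul_lt_mul_of_pos_left h (show 0 < x ^ 2 / 3 by positivity)]

/-- For fixed `x`, the defect increases with the parameter. -/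
theorem logDefect_strictMono {p q x : ℝ} (hp : 0 < p) (hpq : p < q) (hx : 0 < x)
    (hqx : q * x < Real.pi / 2) : logDefect p x < logDefect q x := by
  have := log_cos_mul_div_strictAnti hp hpq hx hqx
  unfold logDefect
  linarith

theorem logDefect_pi_div_two (p : ℝ) :
    logDefect p (Real.pi / 2) =
      Real.log (2 / Real.pi) - 1 / (3 * p ^ 2) * Real.log (Real.cos (p * Real.pi / 2)) := by
  unfold logDefect
  rw [Real.sin_pi_div_two, one_div_div, mul_div_assoc]

/-- An endpoint root is a zero of `p ↦ f_p (π / 2)`; the value `p = 1` drops out because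
`Real.log 0 = 0 ≠ Real.log (2 / π)`. -/
theorem isEndpointRoot_iff {p : ℝ} :
    IsEndpointRoot p ↔ 0 < p ∧ p < 1 ∧ logDefect p (Real.pi / 2) = 0 := by
  rw [logDefect_pi_div_two, sub_eq_zero]
  constructor
  · rintro ⟨⟨h0, h1⟩, h⟩
    refine ⟨h0, lt_of_le_of_ne h1 ?_, h⟩
    rintro rfl
    have h2 : Real.log (2 / Real.pi) < 0 :=
      Real.log_neg (by positivity) (by
        rw [div_lt_one Real.pi_pos]; linarith [Real.pi_gt_three])
    rw [one_mul, Real.cos_pi_div_two, Real.log_zero, mul_zero] at h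
    exact h2.ne h
  · rintro ⟨h0, h1, h⟩
    exact ⟨⟨h0, h1.le⟩, h⟩

theorem IsEndpointRoot.unique {p q : ℝ} (hp : IsEndpointRoot p) (hq : IsEndpointRoot q) :
    q = p := by
  obtain ⟨hp0, hp1, hp⟩ := isEndpointRoot_iff.1 hp
  obtain ⟨hq0, hq1, hq⟩ := isEndpointRoot_iff.1 hq
  have hpi := Real.pi_pos
  rcases lt_trichotomy q p with h | h | h
  · have := logDefect_strictMono hq0 h (by positivity : 0 < Real.pi / 2) (by nlinarith)
    linarith
  · exact h
  · have := logDefect_strictMono hp0 h (by positivity : 0 < Real.pi / 2) (by nlinarith)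
    linarith

/-! ### The derivative in the variable as a series -/

/-- The derivative of `f_p` at `x`. -/
noncomputable def logDefectDeriv (p x : ℝ) : ℝ :=
  Real.cot x - 1 / x + 1 / (3 * p) * Real.tan (p * x)

theorem hasDerivAt_logDefect {p x : ℝ} (hp : 0 < p) (hx : 0 < x) (hxpi : x < Real.pi)
    (hc : Real.cos (p * x) ≠ 0) : HasDerivAt (logDefect p) (logDefectDeriv p x) x := by
  have hs : Real.sin x ≠ 0 := (Real.sin_pos_of_pos_of_lt_pi hx hxpi).ne'
  have h1 := ((Real.hasDerivAt_sin x).div (hasDerivAt_id x) hx.ne').log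
    (div_ne_zero hs hx.ne')
  have h2 := ((((hasDerivAt_id x).const_mul p).cos).log hc).const_mul (1 / (3 * p ^ 2))
  refine (h1.sub h2).congr_deriv ?_
  simp only [logDefectDeriv, Real.cot_eq_cos_div_sin, Real.tan_eq_sin_div_cos, id, Pi.div_apply]
  field_simp
  ring

/-- The Mittag-Leffler expansion of the cotangent, on the real interval `(0, π)`. -/
theorem hasSum_cot_sub_one_div {x : ℝ} (hx : 0 < x) (hxpi : x < Real.pi) :
    HasSum (fun n : ℕ => -(2 * x) / (((n + 1) * Real.pi) ^ 2 - x ^ 2))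
      (Real.cot x - 1 / x) := by
  have hpi := Real.pi_pos
  have hz : ((x / Real.pi : ℝ) : ℂ) ∈ Complex.integerComplement := by
    rw [Complex.mem_integerComplement_iff]
    rintro ⟨n, hn⟩
    have hn' : (n : ℝ) = x / Real.pi := by exact_mod_cast hn
    have h0 : (0 : ℝ) < n := by rw [hn']; positivity
    have h1 : (n : ℝ) < 1 := by rw [hn', div_lt_one hpi]; exact hxpi
    have h0' : 0 < n := by exact_mod_cast h0
    have h1' : n < 1 := by exact_mod_cast h1
    omega
  have hs := (summable_cotTerm hz).hasSum
  have hrep := cot_series_rep' hz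
  simp only [cotTerm] at hs
  rw [← hrep] at hs
  have hs' : HasSum (fun n : ℕ => 1 / (x / Real.pi - (n + 1)) + 1 / (x / Real.pi + (n + 1)))
      (Real.pi * Real.cot (Real.pi * (x / Real.pi)) - 1 / (x / Real.pi)) := by
    rw [← Complex.hasSum_ofReal]
    push_cast
    push_cast at hs
    exact hs
  have hs'' := hs'.mul_left (1 / Real.pi)
  rw [mul_div_cancel₀ x hpi.ne'] at hs''
  have hv : Real.cot x - 1 / x =
      1 / Real.pi * (Real.pi * Real.cot x - 1 / (x / Real.pi)) := by
    field_simp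
  rw [hv]
  refine (congrArg (HasSum · _) (funext fun n => ?_)).mpr hs''
  have hlt : x < (n + 1) * Real.pi := by
    nlinarith [mul_nonneg (Nat.cast_nonneg (α := ℝ) n) hpi.le]
  rw [show x / Real.pi - (n + 1) = (x - (n + 1) * Real.pi) / Real.pi by field_simp,
    show x / Real.pi + (n + 1) = (x + (n + 1) * Real.pi) / Real.pi by field_simp]
  obtain ⟨M, hM⟩ : ∃ M, M = (n + 1) * Real.pi := ⟨_, rfl⟩
  rw [← hM] at hlt ⊢
  have e1 : x - M ≠ 0 := by linarith
  have e2 : x + M ≠ 0 := by linarith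
  rw [show M ^ 2 - x ^ 2 = -((x - M) * (x + M)) by ring]
  field_simp
  ring

theorem tan_eq_cot_sub_two_mul_cot {y : ℝ} (hs : Real.sin y ≠ 0) (hc : Real.cos y ≠ 0) :
    Real.tan y = Real.cot y - 2 * Real.cot (2 * y) := by
  rw [Real.tan_eq_sin_div_cos, Real.cot_eq_cos_div_sin, Real.cot_eq_cos_div_sin,
    Real.sin_two_mul, Real.cos_two_mul']
  field_simp
  ring

/-- One term of the series for `f_p' (x) / x ^ 3`, with `t = x ^ 2` and `N = ((n + 1) π) ^ 2`. -/
noncomputable def derivTerm (p N t : ℝ) : ℝ :=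
  -2 / (N * (N - t)) + 32 * p ^ 2 / 3 / (N * (N - 4 * p ^ 2 * t)) -
    2 * p ^ 2 / 3 / (N * (N - p ^ 2 * t))

/-- The constant and linear contributions of the cotangent expansions cancel, which leaves the
factor `x ^ 3`. -/
theorem hasSum_derivTerm {p x : ℝ} (hp : 0 < p) (hp2 : 2 * p ≤ 1) (hx : 0 < x)
    (hxpi : x < Real.pi) :
    HasSum (fun n : ℕ => derivTerm p (((n + 1) * Real.pi) ^ 2) (x ^ 2))
      (logDefectDeriv p x / x ^ 3) := by
  have hpi := Real.pi_pos
  have hy : 0 < p * x := mul_pos hp hx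
  have hlt2 : 2 * (p * x) < Real.pi := by nlinarith
  have hs : Real.sin (p * x) ≠ 0 :=
    (Real.sin_pos_of_pos_of_lt_pi hy (by linarith)).ne'
  have hc : Real.cos (p * x) ≠ 0 :=
    (Real.cos_pos_of_mem_Ioo ⟨by linarith, by linarith⟩).ne'
  have h1 := hasSum_cot_sub_one_div hx hxpi
  have h2 := hasSum_cot_sub_one_div hy (by linarith)
  have h3 := hasSum_cot_sub_one_div (by positivity : 0 < 2 * (p * x)) hlt2
  have h := (h1.add ((h2.sub (h3.mul_left 2)).mul_left (1 / (3 * p)))).div_const (x ^ 3)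
  have hv : logDefectDeriv p x = Real.cot x - 1 / x + 1 / (3 * p) *
      (Real.cot (p * x) - 1 / (p * x) -
        2 * (Real.cot (2 * (p * x)) - 1 / (2 * (p * x)))) := by
    unfold logDefectDeriv
    rw [tan_eq_cot_sub_two_mul_cot hs hc]
    field_simp
    ring
  rw [hv]
  refine (congrArg (HasSum · _) (funext fun n => ?_)).mpr h
  have hn : Real.pi ≤ (n + 1) * Real.pi := by
    nlinarith [mul_nonneg (Nat.cast_nonneg (α := ℝ) n) hpi.le]
  obtain ⟨M, hM⟩ : ∃ M, M = (n + 1) * Real.pi := ⟨_, rfl⟩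
  rw [← hM] at hn ⊢
  have hM0 : M ≠ 0 := by linarith
  have e1 : M ^ 2 - x ^ 2 ≠ 0 := by nlinarith
  have e2 : M ^ 2 - (p * x) ^ 2 ≠ 0 := by nlinarith
  have e3 : M ^ 2 - (2 * (p * x)) ^ 2 ≠ 0 := by nlinarith
  have e2' : M ^ 2 - p ^ 2 * x ^ 2 ≠ 0 := by rwa [← mul_pow]
  have e3' : M ^ 2 - 4 * p ^ 2 * x ^ 2 ≠ 0 := by
    intro h; apply e3; linarith
  have r2 : M ^ 2 - (p * x) ^ 2 = M ^ 2 - p ^ 2 * x ^ 2 := by ring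
  have r3 : M ^ 2 - (2 * (p * x)) ^ 2 = M ^ 2 - 4 * p ^ 2 * x ^ 2 := by ring
  -- Splitting off the value at `s = 0`: the three constant parts cancel against each other.
  have k : ∀ s : ℝ, M ^ 2 - s ≠ 0 → 1 / (M ^ 2 - s) = 1 / M ^ 2 + s / (M ^ 2 * (M ^ 2 - s)) := by
    intro s hs
    field_simp
    ring
  have t1 := k _ e1
  have t2 := k _ e2'
  have t3 := k _ e3'
  rw [r2, r3, div_eq_mul_one_div (-(2 * x)), div_eq_mul_one_div (-(2 * (p * x))),
    div_eq_mul_one_div (-(2 * (2 * (p * x)))), t1, t2, t3, derivTerm]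
  generalize M ^ 2 - x ^ 2 = A at *
  generalize M ^ 2 - p ^ 2 * x ^ 2 = B at *
  generalize M ^ 2 - 4 * p ^ 2 * x ^ 2 = C at *
  field_simp
  ring

/-- The first two fractions have derivative
`-2 / (N (N - t) ^ 2) + (128 / 3) p ^ 4 / (N (N - 4 p ^ 2 t) ^ 2)`, negative when
`64 p ^ 4 < 3`; the third decreases for every `p`. -/
theorem derivTerm_lt_of_lt {p N s t : ℝ} (hp : 64 * p ^ 4 < 3) (hs : 0 ≤ s)
    (hst : s < t) (htN : t < N) : derivTerm p N t < derivTerm p N s := by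
  have hp2 : 4 * p ^ 2 ≤ 1 := by nlinarith [sq_nonneg (p ^ 2)]
  have hN : 0 < N := by linarith
  have ht : 0 ≤ t := by linarith
  have b1 : 0 < N - s := by linarith
  have b2 : 0 < N - t := by linarith
  have c1 : N - s ≤ N - 4 * p ^ 2 * s := by nlinarith
  have c2 : N - t ≤ N - 4 * p ^ 2 * t := by nlinarith
  have d2 : 0 < N - p ^ 2 * t := by nlinarith [sq_nonneg p]
  have h3 : 2 * p ^ 2 / 3 / (N * (N - p ^ 2 * s)) ≤ 2 * p ^ 2 / 3 / (N * (N - p ^ 2 * t)) := by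
    gcongr
  have k : ∀ c A B : ℝ, 0 < A → 0 < B →
      c / (N * A) - c / (N * B) = c * (B - A) / N * (1 / (B * A)) := by
    intro c A B hA hB
    field_simp
  have e1 : -2 / (N * (N - t)) - -2 / (N * (N - s)) =
      -(2 * (t - s) / N * (1 / ((N - s) * (N - t)))) := by
    rw [k _ _ _ b2 b1]
    ring
  have c1' : 0 < N - 4 * p ^ 2 * s := by linarith
  have c2' : 0 < N - 4 * p ^ 2 * t := by linarith
  have e2 : 32 * p ^ 2 / 3 / (N * (N - 4 * p ^ 2 * t)) -
      32 * p ^ 2 / 3 / (N * (N - 4 * p ^ 2 * s)) =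
      64 * p ^ 4 / 3 * (2 * (t - s) / N * (1 / ((N - 4 * p ^ 2 * s) * (N - 4 * p ^ 2 * t)))) := by
    rw [k _ _ _ c2' c1']
    ring
  have h4 : 2 * (t - s) / N * (1 / ((N - 4 * p ^ 2 * s) * (N - 4 * p ^ 2 * t))) ≤
      2 * (t - s) / N * (1 / ((N - s) * (N - t))) := by
    have : 0 ≤ t - s := by linarith
    gcongr
  have h5 : 0 < 2 * (t - s) / N * (1 / ((N - s) * (N - t))) := by
    have : 0 < t - s := by linarith
    positivity
  have h6 : 0 ≤ p ^ 4 := by positivity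
  have h7 : 64 * p ^ 4 / 3 *
      (2 * (t - s) / N * (1 / ((N - 4 * p ^ 2 * s) * (N - 4 * p ^ 2 * t)))) ≤
      64 * p ^ 4 / 3 * (2 * (t - s) / N * (1 / ((N - s) * (N - t)))) := by gcongr
  unfold derivTerm
  nlinarith

theorem two_mul_le_one_of_pow_four_lt {p : ℝ} (hp : 64 * p ^ 4 < 3) : 2 * p ≤ 1 := by
  by_contra! h
  have h4 : 1 < (2 * p) ^ 4 := one_lt_pow₀ h four_ne_zero
  rw [mul_pow] at h4
  linarith

/-- `f_p' (x) / x ^ 3` is strictly decreasing, since every term of its series is. -/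
theorem logDefectDeriv_div_pow_strictAntiOn {p : ℝ} (hp0 : 0 < p) (hp : 64 * p ^ 4 < 3) :
    StrictAntiOn (fun x => logDefectDeriv p x / x ^ 3) (Set.Ioo 0 Real.pi) := by
  intro x hx y hy hxy
  have hpi := Real.pi_pos
  have hp2 := two_mul_le_one_of_pow_four_lt hp
  have key : ∀ n : ℕ, derivTerm p (((n + 1) * Real.pi) ^ 2) (y ^ 2) <
      derivTerm p (((n + 1) * Real.pi) ^ 2) (x ^ 2) := by
    intro n
    have hn : Real.pi ≤ (n + 1) * Real.pi := by
      nlinarith [mul_nonneg (Nat.cast_nonneg (α := ℝ) n) hpi.le]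
    exact derivTerm_lt_of_lt hp (sq_nonneg x) (pow_lt_pow_left₀ hxy hx.1.le two_ne_zero)
      (pow_lt_pow_left₀ (hy.2.trans_le hn) hy.1.le two_ne_zero)
  exact hasSum_lt (i := 0) (fun n => (key n).le) (key 0) (hasSum_derivTerm hp0 hp2 hy.1 hy.2)
    (hasSum_derivTerm hp0 hp2 hx.1 hx.2)

/-! ### The shape of the defect at a zero of its endpoint value -/

theorem cos_mul_pos_of_two_mul_le_one {p x : ℝ} (hp0 : 0 < p) (hp : 2 * p ≤ 1) (hx : 0 ≤ x)
    (hx2 : x < Real.pi) : 0 < Real.cos (p * x) := by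
  apply Real.cos_pos_of_mem_Ioo
  constructor <;> nlinarith [Real.pi_pos, mul_nonneg hp0.le hx]

/-- At `x = 0` the convention `log (0 / 0) = 0` agrees with `log (sinc 0) = log 1`. -/
theorem logDefect_eq_log_sinc (p x : ℝ) :
    logDefect p x = Real.log (Real.sinc x) - 1 / (3 * p ^ 2) * Real.log (Real.cos (p * x)) := by
  rcases eq_or_ne x 0 with rfl | hx
  · simp [logDefect]
  · rw [logDefect, Real.sinc_of_ne_zero hx]

theorem logDefect_zero (p : ℝ) : logDefect p 0 = 0 := by
  simp [logDefect]

theorem continuousAt_logDefect {p x : ℝ} (hx : 0 ≤ x) (hxpi : x < Real.pi)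
    (hc : Real.cos (p * x) ≠ 0) : ContinuousAt (logDefect p) x := by
  have hs : Real.sinc x ≠ 0 := by
    rcases hx.eq_or_lt with rfl | h
    · simp
    · rw [Real.sinc_of_ne_zero h.ne']
      exact div_ne_zero (Real.sin_pos_of_pos_of_lt_pi h hxpi).ne' h.ne'
  rw [show logDefect p = _ from funext (logDefect_eq_log_sinc p)]
  have h1 : ContinuousAt Real.sinc x := Real.continuous_sinc.continuousAt
  have h2 : ContinuousAt (fun x => Real.cos (p * x)) x := by fun_prop
  exact (h1.log hs).sub (continuousAt_const.mul (h2.log hc))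

theorem continuousOn_logDefect {p : ℝ} (hp0 : 0 < p) (hp : 2 * p ≤ 1) :
    ContinuousOn (logDefect p) (Set.Ico 0 Real.pi) := fun _ hx =>
  (continuousAt_logDefect hx.1 hx.2
    (cos_mul_pos_of_two_mul_le_one hp0 hp hx.1 hx.2).ne').continuousWithinAt

theorem hasDerivAt_logDefect_of_two_mul_le_one {p x : ℝ} (hp0 : 0 < p) (hp : 2 * p ≤ 1)
    (hx : 0 < x) (hxpi : x < Real.pi) : HasDerivAt (logDefect p) (logDefectDeriv p x) x :=
  hasDerivAt_logDefect hp0 hx hxpi (cos_mul_pos_of_two_mul_le_one hp0 hp hx.le hxpi).ne'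

theorem isCriticalPoint_iff {p x : ℝ} (hp0 : 0 < p) (hp : 2 * p ≤ 1) :
    IsCriticalPoint p x ↔ x ∈ Set.Ioo (0 : ℝ) (Real.pi / 2) ∧ logDefectDeriv p x = 0 := by
  refine and_congr_right fun hx => ?_
  have h := hasDerivAt_logDefect_of_two_mul_le_one hp0 hp hx.1 (by linarith [hx.2, Real.pi_pos])
  exact ⟨fun h0 => h.unique h0, fun h0 => h0 ▸ h⟩

/-- Rolle's theorem: the defect vanishes at `0` and at `π / 2`. -/
theorem exists_isCriticalPoint {p : ℝ} (hp0 : 0 < p) (hp : 2 * p ≤ 1)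
    (hend : logDefect p (Real.pi / 2) = 0) : ∃ x, IsCriticalPoint p x := by
  have hpi := Real.pi_pos
  obtain ⟨c, hc, hc0⟩ := exists_hasDerivAt_eq_zero (f := logDefect p) (f' := logDefectDeriv p)
    (by positivity : 0 < Real.pi / 2)
    ((continuousOn_logDefect hp0 hp).mono fun x hx => ⟨hx.1, by linarith [hx.2]⟩)
    (by rw [hend, logDefect_zero])
    (fun x hx => hasDerivAt_logDefect_of_two_mul_le_one hp0 hp hx.1 (by linarith [hx.2]))
  exact ⟨c, (isCriticalPoint_iff hp0 hp).2 ⟨hc, hc0⟩⟩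

theorem logDefectDeriv_pos_of_lt {p x y : ℝ} (hp0 : 0 < p) (hp : 64 * p ^ 4 < 3)
    (hy : IsCriticalPoint p y) (hx : 0 < x) (hxy : x < y) : 0 < logDefectDeriv p x := by
  obtain ⟨hy, hy0⟩ := (isCriticalPoint_iff hp0 (two_mul_le_one_of_pow_four_lt hp)).1 hy
  have hpi := Real.pi_pos
  have h := logDefectDeriv_div_pow_strictAntiOn hp0 hp
    ⟨hx, by linarith [hy.2]⟩ ⟨hy.1, by linarith [hy.2]⟩ hxy
  simp only [hy0, zero_div] at h
  exact (div_pos_iff_of_pos_right (pow_pos hx 3)).1 h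

theorem logDefectDeriv_neg_of_lt {p x y : ℝ} (hp0 : 0 < p) (hp : 64 * p ^ 4 < 3)
    (hy : IsCriticalPoint p y) (hyx : y < x) (hx : x < Real.pi) : logDefectDeriv p x < 0 := by
  obtain ⟨hy, hy0⟩ := (isCriticalPoint_iff hp0 (two_mul_le_one_of_pow_four_lt hp)).1 hy
  have hpi := Real.pi_pos
  have hx0 := hy.1.trans hyx
  have h := logDefectDeriv_div_pow_strictAntiOn hp0 hp
    ⟨hy.1, by linarith [hy.2]⟩ ⟨hx0, hx⟩ hyx
  simp only [hy0, zero_div] at h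
  by_contra! hge
  exact absurd h (not_lt.2 (div_nonneg hge (pow_pos hx0 3).le))

theorem IsCriticalPoint.unique {p x y : ℝ} (hp0 : 0 < p) (hp : 64 * p ^ 4 < 3)
    (hx : IsCriticalPoint p x) (hy : IsCriticalPoint p y) : y = x := by
  have hpi := Real.pi_pos
  have hy' := (isCriticalPoint_iff hp0 (two_mul_le_one_of_pow_four_lt hp)).1 hy
  rcases lt_trichotomy y x with h | h | h
  · exact absurd hy'.2 (logDefectDeriv_pos_of_lt hp0 hp hx hy'.1.1 h).ne'
  · exact h
  · exact absurd hy'.2 (logDefectDeriv_neg_of_lt hp0 hp hx h (by linarith [hy'.1.2])).ne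

theorem strictMonoOn_logDefect {p y : ℝ} (hp0 : 0 < p) (hp : 64 * p ^ 4 < 3)
    (hy : IsCriticalPoint p y) : StrictMonoOn (logDefect p) (Set.Icc 0 y) := by
  have hpi := Real.pi_pos
  have hp2 := two_mul_le_one_of_pow_four_lt hp
  have hy2 := hy.1.2
  apply strictMonoOn_of_deriv_pos (convex_Icc _ _)
    ((continuousOn_logDefect hp0 hp2).mono fun x hx => ⟨hx.1, by linarith [hx.2]⟩)
  intro x hx
  rw [interior_Icc] at hx
  rw [(hasDerivAt_logDefect_of_two_mul_le_one hp0 hp2 hx.1 (by linarith [hx.2])).deriv]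
  exact logDefectDeriv_pos_of_lt hp0 hp hy hx.1 hx.2

theorem strictAntiOn_logDefect {p y : ℝ} (hp0 : 0 < p) (hp : 64 * p ^ 4 < 3)
    (hy : IsCriticalPoint p y) : StrictAntiOn (logDefect p) (Set.Icc y (Real.pi / 2)) := by
  have hpi := Real.pi_pos
  have hp2 := two_mul_le_one_of_pow_four_lt hp
  have hy1 := hy.1.1
  apply strictAntiOn_of_deriv_neg (convex_Icc _ _)
    ((continuousOn_logDefect hp0 hp2).mono fun x hx =>
      ⟨by linarith [hx.1], by linarith [hx.2]⟩)
  intro x hx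
  rw [interior_Icc] at hx
  rw [(hasDerivAt_logDefect_of_two_mul_le_one hp0 hp2 (by linarith [hx.1])
    (by linarith [hx.2])).deriv]
  exact logDefectDeriv_neg_of_lt hp0 hp hy hx.1 (by linarith [hx.2])

theorem logDefect_lt_of_ne {p x y : ℝ} (hp0 : 0 < p) (hp : 64 * p ^ 4 < 3)
    (hy : IsCriticalPoint p y) (hx : x ∈ Set.Ioo (0 : ℝ) (Real.pi / 2)) (hxy : x ≠ y) :
    logDefect p x < logDefect p y := by
  rcases hxy.lt_or_gt with h | h
  · exact strictMonoOn_logDefect hp0 hp hy ⟨hx.1.le, h.le⟩ ⟨hy.1.1.le, le_rfl⟩ h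
  · exact strictAntiOn_logDefect hp0 hp hy ⟨le_rfl, hy.1.2.le⟩ ⟨h.le, hx.2.le⟩ h

theorem logDefect_pos {p x : ℝ} (hp0 : 0 < p) (hp : 64 * p ^ 4 < 3)
    (hend : logDefect p (Real.pi / 2) = 0) (hx : x ∈ Set.Ioo (0 : ℝ) (Real.pi / 2)) :
    0 < logDefect p x := by
  obtain ⟨y, hy⟩ := exists_isCriticalPoint hp0 (two_mul_le_one_of_pow_four_lt hp) hend
  rcases le_total x y with h | h
  · rw [← logDefect_zero p]
    exact strictMonoOn_logDefect hp0 hp hy ⟨le_rfl, hy.1.1.le⟩ ⟨hx.1.le, h⟩ hx.1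
  · rw [← hend]
    exact strictAntiOn_logDefect hp0 hp hy ⟨h, hx.2.le⟩ ⟨hy.1.2.le, le_rfl⟩ hx.2

/-- The maximum value of the defect is controlled by its value and slope at a point `a` to the
left of the maximum, because `f_p' (c) / c ^ 3 ≤ f_p' (a) / a ^ 3` for `c ≥ a`. -/
theorem logDefect_sub_le {p a y : ℝ} (hp0 : 0 < p) (hp : 64 * p ^ 4 < 3) (ha : 0 < a)
    (hay : a < y) (hy : y < Real.pi) (hd : 0 ≤ logDefectDeriv p a) :
    logDefect p y - logDefect p a ≤ logDefectDeriv p a * (y / a) ^ 3 * (y - a) := by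
  have hp2 := two_mul_le_one_of_pow_four_lt hp
  obtain ⟨c, hc, hc'⟩ := exists_hasDerivAt_eq_slope (logDefect p) (logDefectDeriv p) hay
    ((continuousOn_logDefect hp0 hp2).mono fun x hx => ⟨by linarith [hx.1], by linarith [hx.2]⟩)
    (fun x hx => hasDerivAt_logDefect_of_two_mul_le_one hp0 hp2 (by linarith [hx.1])
      (by linarith [hx.2]))
  have hya : 0 < y - a := by linarith
  have hc0 : 0 < c := ha.trans hc.1
  rw [eq_div_iff hya.ne'] at hc'
  rw [← hc']
  have h := logDefectDeriv_div_pow_strictAntiOn hp0 hp ⟨ha, hay.trans hy⟩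
    ⟨hc0, hc.2.trans hy⟩ hc.1
  simp only at h
  rw [div_lt_iff₀ (pow_pos hc0 3)] at h
  have h2 : logDefectDeriv p a / a ^ 3 * c ^ 3 ≤ logDefectDeriv p a * (y / a) ^ 3 := by
    rw [div_pow, div_mul_eq_mul_div, mul_div_assoc]
    have := hc.2.le
    gcongr
  exact mul_le_mul_of_nonneg_right (h.le.trans h2) hya.le

/-! ### Location of the endpoint root -/

theorem log_two_div_pi_bounds :
    -0.45158270528945486473 ≤ Real.log (2 / Real.pi) ∧
      Real.log (2 / Real.pi) ≤ -0.45158270528945486472 := by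
  have hpi := Real.pi_pos
  have h1 : (2 : ℝ) / 3.14159265358979323847 ≤ 2 / Real.pi := by
    have := Real.pi_lt_d20.le
    gcongr
  have h2 : 2 / Real.pi ≤ (2 : ℝ) / 3.14159265358979323846 := by
    have := Real.pi_gt_d20.le
    gcongr
  constructor
  · refine (neg_le_log_of_one_le_mul_sum (by norm_num) (by norm_num) 19 ?_).trans
      (Real.log_le_log (by norm_num) h1)
    norm_num [Finset.sum_range_succ, Nat.factorial]
  · refine (Real.log_le_log (by positivity) h2).trans
      (log_le_neg_of_mul_sum_le_one (by norm_num) (by norm_num) (by norm_num)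
        (n := 17) (by norm_num) ?_)
    norm_num [Finset.sum_range_succ, Nat.factorial]

/-- The decision is close: `log cos (p π / 2)` exceeds `3 p ^ 2 log (2 / π)` by about `4 * 10⁻¹⁶`, so
each enclosure is taken to an accuracy of `10⁻¹⁶` or better. The decimal `0.7123…` is an upper
bound for `p π / 2`. -/
theorem logDefect_pi_div_two_neg : logDefect 0.45346830977067 (Real.pi / 2) < 0 := by
  have hpi := Real.pi_gt_d20
  have hpi' := Real.pi_lt_d20
  have hcos : (0.75685650008038995 : ℝ) ≤ Real.cos (0.45346830977067 * (Real.pi / 2)) := by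
    have h1 := (abs_le.1
      (abs_cos_sub_taylor_le 0.712306355305658765 10 (by norm_num [abs_of_pos]))).1
    norm_num [Finset.sum_range_succ, Nat.factorial, abs_of_pos] at h1
    have h2 : Real.cos 0.712306355305658765 ≤ Real.cos (0.45346830977067 * (Real.pi / 2)) := by
      apply Real.cos_le_cos_of_nonneg_of_le_pi <;> linarith
    norm_num at h2 ⊢
    linarith
  have hlog : -0.2785816074767040 ≤ Real.log (Real.cos (0.45346830977067 * (Real.pi / 2))) := by
    refine (neg_le_log_of_one_le_mul_sum (by norm_num) (by norm_num) 15 ?_).trans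
      (Real.log_le_log (by norm_num) hcos)
    norm_num [Finset.sum_range_succ, Nat.factorial]
  have h := log_two_div_pi_bounds.2
  rw [logDefect, Real.sin_pi_div_two, one_div_div]
  linarith

/-- Here `log cos (p π / 2)` falls short of `3 p ^ 2 log (2 / π)` by about `8 * 10⁻¹⁶`, and the
decimal `0.7123…` is a lower bound for `p π / 2`. -/
theorem logDefect_pi_div_two_pos : 0 < logDefect 0.45346830977068 (Real.pi / 2) := by
  have hpi := Real.pi_gt_d20
  have hpi' := Real.pi_lt_d20
  have hcos : Real.cos (0.45346830977068 * (Real.pi / 2)) ≤ (0.7568565000803797 : ℝ) := by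
    have h1 := (abs_le.1
      (abs_cos_sub_taylor_le 0.71230635530567447 10 (by norm_num [abs_of_pos]))).2
    norm_num [Finset.sum_range_succ, Nat.factorial, abs_of_pos] at h1
    have h2 : Real.cos (0.45346830977068 * (Real.pi / 2)) ≤ Real.cos 0.71230635530567447 := by
      apply Real.cos_le_cos_of_nonneg_of_le_pi <;> linarith
    norm_num at h2 ⊢
    linarith
  have hpos : 0 < Real.cos (0.45346830977068 * (Real.pi / 2)) :=
    cos_mul_pos_of_two_mul_le_one (by norm_num) (by norm_num) (by linarith) (by linarith)
  have hlog : Real.log (Real.cos (0.45346830977068 * (Real.pi / 2))) ≤ -0.2785816074767170 := by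
    refine (Real.log_le_log hpos hcos).trans
      (log_le_neg_of_mul_sum_le_one (by norm_num) (by norm_num) (by norm_num)
        (n := 15) (by norm_num) ?_)
    norm_num [Finset.sum_range_succ, Nat.factorial]
  have h := log_two_div_pi_bounds.1
  rw [logDefect, Real.sin_pi_div_two, one_div_div]
  linarith

theorem exists_isEndpointRoot :
    ∃ p, IsEndpointRoot p ∧ 0.45346830977067 ≤ p ∧ p < 0.45346830977068 := by
  have hpi := Real.pi_pos
  have hcont : ContinuousOn (fun p => logDefect p (Real.pi / 2))
      (Set.Icc 0.45346830977067 0.45346830977068) := by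
    intro p hp
    have hp0 : (0 : ℝ) < p := lt_of_lt_of_le (by norm_num) hp.1
    have hp2 : 2 * p ≤ 1 := by
      have := hp.2
      norm_num at this ⊢
      linarith
    have hc : Real.cos (p * (Real.pi / 2)) ≠ 0 :=
      (cos_mul_pos_of_two_mul_le_one hp0 hp2 (by positivity) (by linarith)).ne'
    unfold logDefect
    have h2 : ContinuousAt (fun p : ℝ => Real.cos (p * (Real.pi / 2))) p := by fun_prop
    have h3 : ContinuousAt (fun p : ℝ => 1 / (3 * p ^ 2)) p := by
      apply ContinuousAt.div₀ <;> first | fun_prop | positivity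
    exact (continuousAt_const.sub (h3.mul (h2.log hc))).continuousWithinAt
  obtain ⟨p, hp, h0⟩ := intermediate_value_Ioo (by norm_num) hcont
    ⟨logDefect_pi_div_two_neg, logDefect_pi_div_two_pos⟩
  have hp1 : (0.45346830977068 : ℝ) < 1 := by norm_num
  exact ⟨p, isEndpointRoot_iff.2 ⟨lt_trans (by norm_num) hp.1, hp.2.trans hp1, h0⟩, hp.1.le, hp.2⟩

/-! ### The size of the maximum -/

/-- At `13 / 10` the slope is positive but tiny, so this point lies just to the left of the
maximum. -/
theorem logDefect_bounds_thirteen_tenths {p : ℝ} (hp : 0.45346830977067 ≤ p)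
    (hp' : p < 0.45346830977068) :
    (0.00016 < logDefect p 1.3 ∧ logDefect p 1.3 < 0.0002) ∧
      0 < logDefectDeriv p 1.3 ∧ logDefectDeriv p 1.3 < 0.00005 := by
  have hpi := Real.pi_gt_d2
  have hp0 : 0 < p := lt_of_lt_of_le (by norm_num) hp
  have s1 : (0.96355818541 : ℝ) ≤ Real.sin 1.3 ∧ Real.sin 1.3 ≤ 0.96355818542 := by
    have h := abs_le.1 (abs_sin_sub_taylor_le 1.3 10 (by norm_num [abs_of_pos]))
    norm_num [Finset.sum_range_succ, Nat.factorial, abs_of_pos] at h ⊢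
    constructor <;> linarith [h.1, h.2]
  have c1 : (0.26749882862 : ℝ) ≤ Real.cos 1.3 ∧ Real.cos 1.3 ≤ 0.26749882863 := by
    have h := abs_le.1 (abs_cos_sub_taylor_le 1.3 10 (by norm_num [abs_of_pos]))
    norm_num [Finset.sum_range_succ, Nat.factorial, abs_of_pos] at h ⊢
    constructor <;> linarith [h.1, h.2]
  -- Monotonicity transfers the enclosures at the two ends of the range of `p * 1.3`.
  have b1 : 0.589508802701 ≤ p * 1.3 := by linarith
  have b2 : p * 1.3 ≤ 0.589508802702 := by linarith
  have s2 : (0.5559527997 : ℝ) ≤ Real.sin (p * 1.3) ∧ Real.sin (p * 1.3) ≤ 0.5559528 := by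
    have h := abs_le.1 (abs_sin_sub_taylor_le 0.589508802701 8 (by norm_num [abs_of_pos]))
    have h' := abs_le.1 (abs_sin_sub_taylor_le 0.589508802702 8 (by norm_num [abs_of_pos]))
    norm_num [Finset.sum_range_succ, Nat.factorial, abs_of_pos] at h h'
    have m1 : Real.sin 0.589508802701 ≤ Real.sin (p * 1.3) :=
      Real.sin_le_sin_of_le_of_le_pi_div_two (by linarith) (by linarith) b1
    have m2 : Real.sin (p * 1.3) ≤ Real.sin 0.589508802702 :=
      Real.sin_le_sin_of_le_of_le_pi_div_two (by linarith) (by linarith) b2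
    norm_num at m1 m2 ⊢
    constructor <;> linarith [h.1, h'.2]
  have c2 : (0.8312138618 : ℝ) ≤ Real.cos (p * 1.3) ∧ Real.cos (p * 1.3) ≤ 0.8312138619 := by
    have h := abs_le.1 (abs_cos_sub_taylor_le 0.589508802701 8 (by norm_num [abs_of_pos]))
    have h' := abs_le.1 (abs_cos_sub_taylor_le 0.589508802702 8 (by norm_num [abs_of_pos]))
    norm_num [Finset.sum_range_succ, Nat.factorial, abs_of_pos] at h h'
    have m1 : Real.cos (p * 1.3) ≤ Real.cos 0.589508802701 :=
      Real.cos_le_cos_of_nonneg_of_le_pi (by linarith) (by linarith) b1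
    have m2 : Real.cos 0.589508802702 ≤ Real.cos (p * 1.3) :=
      Real.cos_le_cos_of_nonneg_of_le_pi (by linarith) (by linarith) b2
    norm_num at m1 m2 ⊢
    constructor <;> linarith [h.2, h'.1]
  have cpos : 0 < Real.cos (p * 1.3) := lt_of_lt_of_le (by norm_num) c2.1
  have spos : 0 < Real.sin 1.3 := lt_of_lt_of_le (by norm_num) s1.1
  have l1 : -0.29948668 ≤ Real.log (Real.sin 1.3 / 1.3) := by
    refine (neg_le_log_of_one_le_mul_sum (x := 0.96355818541 / 1.3) (by norm_num) (by norm_num)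
      10 ?_).trans (Real.log_le_log (by norm_num) ?_)
    · norm_num [Finset.sum_range_succ, Nat.factorial]
    · have := s1.1
      gcongr
  have l1' : Real.log (Real.sin 1.3 / 1.3) ≤ -0.29948666 := by
    refine (Real.log_le_log (y := 0.96355818542 / 1.3) (by positivity) ?_).trans
      (log_le_neg_of_mul_sum_le_one (by norm_num) (by norm_num) (by norm_num)
        (n := 10) (by norm_num) ?_)
    · have := s1.2
      gcongr
    · norm_num [Finset.sum_range_succ, Nat.factorial]
  have l2 : -0.18486817 ≤ Real.log (Real.cos (p * 1.3)) := by
    refine (neg_le_log_of_one_le_mul_sum (by norm_num) (by norm_num)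
      10 ?_).trans (Real.log_le_log (by norm_num) c2.1)
    norm_num [Finset.sum_range_succ, Nat.factorial]
  have l2' : Real.log (Real.cos (p * 1.3)) ≤ -0.18486816 := by
    refine (Real.log_le_log cpos c2.2).trans
      (log_le_neg_of_mul_sum_le_one (by norm_num) (by norm_num) (by norm_num)
        (n := 10) (by norm_num) ?_)
    norm_num [Finset.sum_range_succ, Nat.factorial]
  have k1 : 1.6210068 ≤ 1 / (3 * p ^ 2) := by
    rw [le_div_iff₀ (by positivity)]
    nlinarith
  have k2 : 1 / (3 * p ^ 2) ≤ 1.621007 := by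
    rw [div_le_iff₀ (by positivity)]
    nlinarith
  have t1 : 0.277609 ≤ Real.cot 1.3 := by
    rw [Real.cot_eq_cos_div_sin, le_div_iff₀ spos]
    linarith
  have t1' : Real.cot 1.3 ≤ 0.277622 := by
    rw [Real.cot_eq_cos_div_sin, div_le_iff₀ spos]
    linarith
  have t2 : 0.668838 ≤ Real.tan (p * 1.3) := by
    rw [Real.tan_eq_sin_div_cos, le_div_iff₀ cpos]
    linarith
  have t2' : Real.tan (p * 1.3) ≤ 0.66885 := by
    rw [Real.tan_eq_sin_div_cos, div_le_iff₀ cpos]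
    linarith
  have k3 : 0.735075 ≤ 1 / (3 * p) := by
    rw [le_div_iff₀ (by positivity)]
    linarith
  have k4 : 1 / (3 * p) ≤ 0.735077 := by
    rw [div_le_iff₀ (by positivity)]
    linarith
  refine ⟨⟨?_, ?_⟩, ?_, ?_⟩
  · unfold logDefect
    nlinarith
  · unfold logDefect
    nlinarith
  · unfold logDefectDeriv
    nlinarith
  · unfold logDefectDeriv
    nlinarith

/-! ### Translation to the power inequalities -/

theorem cosPow_eq_exp {p x : ℝ} (hc : 0 < Real.cos (p * x)) :
    cosPow p x = Real.exp (1 / (3 * p ^ 2) * Real.log (Real.cos (p * x))) := by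
  rw [cosPow, Real.rpow_def_of_pos hc, mul_comm]

theorem cosPow_pos {p x : ℝ} (hc : 0 < Real.cos (p * x)) : 0 < cosPow p x := by
  rw [cosPow_eq_exp hc]
  exact Real.exp_pos _

theorem sin_div_eq_exp_logDefect_mul_cosPow {p x : ℝ} (hc : 0 < Real.cos (p * x)) (hx : 0 < x)
    (hxpi : x < Real.pi) : Real.sin x / x = Real.exp (logDefect p x) * cosPow p x := by
  rw [cosPow_eq_exp hc, ← Real.exp_add, logDefect, sub_add_cancel,
    Real.exp_log (div_pos (Real.sin_pos_of_pos_of_lt_pi hx hxpi) hx)]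

theorem cosPow_lt_sin_div_iff {p x : ℝ} (hc : 0 < Real.cos (p * x)) (hx : 0 < x)
    (hxpi : x < Real.pi) : cosPow p x < Real.sin x / x ↔ 0 < logDefect p x := by
  rw [sin_div_eq_exp_logDefect_mul_cosPow hc hx hxpi, lt_mul_iff_one_lt_left (cosPow_pos hc),
    Real.one_lt_exp_iff]

/-- Below the endpoint root the defect is negative at `π / 2`, hence also at some interior
point. -/
theorem exists_logDefect_neg {p : ℝ} (hp0 : 0 < p) (hp1 : p < 1)
    (hend : logDefect p (Real.pi / 2) < 0) :
    ∃ x ∈ Set.Ioo (0 : ℝ) (Real.pi / 2), logDefect p x < 0 := by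
  have hpi := Real.pi_pos
  have hc : 0 < Real.cos (p * (Real.pi / 2)) := by
    apply Real.cos_pos_of_mem_Ioo
    constructor <;> nlinarith
  have hcont := continuousAt_logDefect (by positivity : 0 ≤ Real.pi / 2) (by linarith) hc.ne'
  have h1 : ∀ᶠ x in nhdsWithin (Real.pi / 2) (Set.Iio (Real.pi / 2)), logDefect p x < 0 :=
    (hcont.eventually_lt_const hend).filter_mono nhdsWithin_le_nhds
  obtain ⟨x, hx, hx'⟩ := (h1.and (Ioo_mem_nhdsLT (by positivity : 0 < Real.pi / 2))).exists
  exact ⟨x, hx', hx⟩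

theorem cosPow_lt_sin_div_forall_iff {p₁ p : ℝ} (hp₁ : IsEndpointRoot p₁)
    (hsmall : 64 * p₁ ^ 4 < 3) (hp : p ∈ Set.Ioc (0 : ℝ) 1) :
    (∀ x ∈ Set.Ioo (0 : ℝ) (Real.pi / 2), Real.sin x / x > cosPow p x) ↔ p ∈ Set.Icc p₁ 1 := by
  obtain ⟨h0, h1, hend⟩ := isEndpointRoot_iff.1 hp₁
  have hpi := Real.pi_pos
  have hcos : ∀ x ∈ Set.Ioo (0 : ℝ) (Real.pi / 2), 0 < Real.cos (p * x) := fun x hx =>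
    cos_parameter_mul_pos hp.1 hp.2 hx.1 hx.2
  constructor
  · intro h
    refine ⟨?_, hp.2⟩
    by_contra! hlt
    have hneg := logDefect_strictMono hp.1 hlt (by positivity : 0 < Real.pi / 2) (by nlinarith)
    rw [hend] at hneg
    obtain ⟨x, hx, hx0⟩ := exists_logDefect_neg hp.1 (hlt.trans h1) hneg
    have := (cosPow_lt_sin_div_iff (hcos x hx) hx.1 (by linarith [hx.2])).1 (h x hx)
    linarith
  · rintro ⟨hle, -⟩ x hx
    refine (cosPow_lt_sin_div_iff (hcos x hx) hx.1 (by linarith [hx.2])).2 ?_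
    have hpos := logDefect_pos h0 hsmall hend hx
    rcases hle.eq_or_lt with rfl | hlt
    · exact hpos
    · refine hpos.trans (logDefect_strictMono h0 hlt hx.1 ?_)
      nlinarith [hx.1, hx.2, hp.2]

/-- The constant `1` cannot be enlarged, because `f_p (x) → 0` as `x → 0`. -/
theorem le_one_of_mul_cosPow_lt {p a : ℝ} (hp0 : 0 < p) (hp1 : p ≤ 1)
    (ha : ∀ x ∈ Set.Ioo (0 : ℝ) (Real.pi / 2), a * cosPow p x < Real.sin x / x) : a ≤ 1 := by
  have hpi := Real.pi_pos
  have hcont : ContinuousAt (fun x => Real.exp (logDefect p x)) 0 :=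
    Real.continuous_exp.continuousAt.comp
      (continuousAt_logDefect le_rfl hpi (by simp))
  have hlim : Filter.Tendsto (fun x => Real.exp (logDefect p x))
      (nhdsWithin 0 (Set.Ioi 0)) (nhds 1) := by
    have := hcont.tendsto.mono_left (nhdsWithin_le_nhds (s := Set.Ioi 0))
    rwa [logDefect_zero, Real.exp_zero] at this
  refine ge_of_tendsto hlim ?_
  filter_upwards [Ioo_mem_nhdsGT (by positivity : 0 < Real.pi / 2)] with x hx
  have hc := cos_parameter_mul_pos hp0 hp1 hx.1 hx.2
  have h := ha x hx
  rw [sin_div_eq_exp_logDefect_mul_cosPow hc hx.1 (by linarith [hx.2])] at h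
  exact (lt_of_mul_lt_mul_right h (cosPow_pos hc).le).le

/-- The maximum of the defect lies in `(0.00016, 0.00023)`. -/
theorem abs_exp_logDefect_sub_lt {p y : ℝ} (hp : 0.45346830977067 ≤ p)
    (hp' : p < 0.45346830977068) (hsmall : 64 * p ^ 4 < 3) (hy : IsCriticalPoint p y) :
    |Real.exp (logDefect p y) - 1.0002| < 0.00005 := by
  have hpi := Real.pi_gt_d2
  have hpi' := Real.pi_lt_d2
  have hp0 : 0 < p := lt_of_lt_of_le (by norm_num) hp
  obtain ⟨⟨hf1, hf2⟩, hd1, hd2⟩ := logDefect_bounds_thirteen_tenths hp hp'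
  have hmem : (1.3 : ℝ) ∈ Set.Ioo (0 : ℝ) (Real.pi / 2) := ⟨by norm_num, by linarith⟩
  -- The positive slope at `13 / 10` places this point to the left of the maximum.
  have hlt : 1.3 < y := by
    by_contra! h
    rcases h.eq_or_lt with h | h
    · have := (isCriticalPoint_iff hp0 (two_mul_le_one_of_pow_four_lt hsmall)).1 hy
      rw [h] at this
      linarith [this.2]
    · have := logDefectDeriv_neg_of_lt hp0 hsmall hy h (by linarith)
      linarith
  have hy2 := hy.1.2
  have hlow := logDefect_lt_of_ne hp0 hsmall hy hmem hlt.ne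
  have hup := logDefect_sub_le hp0 hsmall (by norm_num) hlt (by linarith) hd1.le
  -- `1.3 < y < π / 2 < 1.575` gives `y / 1.3 < 1.22` and `y - 1.3 < 0.28`.
  have hcube : (y / 1.3) ^ 3 ≤ (1.22 : ℝ) ^ 3 := by
    have h1 : y / 1.3 ≤ 1.22 := by
      rw [div_le_iff₀ (by norm_num)]
      linarith
    have h2 : 0 ≤ y / 1.3 := div_nonneg hy.1.1.le (by norm_num)
    gcongr
  have hprod : logDefectDeriv p 1.3 * (y / 1.3) ^ 3 * (y - 1.3) ≤
      0.00005 * (1.22 : ℝ) ^ 3 * 0.28 := by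
    have h3 : y - 1.3 ≤ 0.28 := by linarith
    have h4 : 0 ≤ y - 1.3 := by linarith
    have h5 : 0 ≤ (y / 1.3) ^ 3 := pow_nonneg (div_nonneg hy.1.1.le (by norm_num)) 3
    gcongr
  have hmax : logDefect p y < 0.00023 := by
    have h6 : (0.00005 : ℝ) * 1.22 ^ 3 * 0.28 < 0.00003 := by norm_num
    linarith
  have hexp1 := Real.add_one_le_exp (logDefect p y)
  have hexp2 : Real.exp (logDefect p y) ≤ 1 / (1 - logDefect p y) :=
    Real.exp_bound_div_one_sub_of_interval (by linarith) (by linarith)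
  have hexp3 : 1 / (1 - logDefect p y) < 1.00025 := by
    rw [div_lt_iff₀ (by linarith)]
    linarith
  rw [abs_lt]
  constructor <;> linarith

theorem mainTheorem1 :
    ∃ p₁ x₀ β : ℝ,
      -- `p₁ = 0.45346830977067...` is the unique root
      (IsEndpointRoot p₁ ∧ ∀ q : ℝ, IsEndpointRoot q → q = p₁) ∧
      (0.45346830977067 ≤ p₁ ∧ p₁ < 0.45346830977068) ∧
      -- the characterization of the admissible exponents
      (∀ p ∈ Set.Ioc (0 : ℝ) 1,
        (∀ x ∈ Set.Ioo (0 : ℝ) (Real.pi / 2), Real.sin x / x > cosPow p x) ↔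
          p ∈ Set.Icc p₁ 1) ∧
      -- `x₀` is the unique critical point of `f_{p₁}`, and `β = exp (f_{p₁}(x₀)) ≈ 1.0002`
      (IsCriticalPoint p₁ x₀ ∧ ∀ y : ℝ, IsCriticalPoint p₁ y → y = x₀) ∧
      β = Real.exp (logDefect p₁ x₀) ∧
      |β - 1.0002| < 0.00005 ∧
      -- the two-sided inequality; the upper bound is attained exactly at `x₀`
      (∀ x ∈ Set.Ioo (0 : ℝ) (Real.pi / 2),
        cosPow p₁ x < Real.sin x / x ∧
        Real.sin x / x ≤ β * cosPow p₁ x ∧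
        (Real.sin x / x = β * cosPow p₁ x ↔ x = x₀)) ∧
      -- the constants `1` and `β` are best possible
      IsGreatest {a : ℝ | ∀ x ∈ Set.Ioo (0 : ℝ) (Real.pi / 2),
        a * cosPow p₁ x < Real.sin x / x} 1 ∧
      IsLeast {b : ℝ | ∀ x ∈ Set.Ioo (0 : ℝ) (Real.pi / 2),
        Real.sin x / x ≤ b * cosPow p₁ x} β := by
  have hpi := Real.pi_pos
  obtain ⟨p, hroot, hp, hp'⟩ := exists_isEndpointRoot
  obtain ⟨hp0, hp1, hend⟩ := isEndpointRoot_iff.1 hroot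
  have hsmall : 64 * p ^ 4 < 3 := by
    have h : p ^ 4 ≤ (0.45346830977068 : ℝ) ^ 4 := by gcongr
    norm_num at h
    linarith
  have hp2 := two_mul_le_one_of_pow_four_lt hsmall
  obtain ⟨y, hy⟩ := exists_isCriticalPoint hp0 hp2 hend
  have hcos : ∀ x ∈ Set.Ioo (0 : ℝ) (Real.pi / 2), 0 < Real.cos (p * x) := fun x hx =>
    cos_parameter_mul_pos hp0 hp1.le hx.1 hx.2
  have hfac : ∀ x ∈ Set.Ioo (0 : ℝ) (Real.pi / 2),
      Real.sin x / x = Real.exp (logDefect p x) * cosPow p x := fun x hx =>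
    sin_div_eq_exp_logDefect_mul_cosPow (hcos x hx) hx.1 (by linarith [hx.2])
  have hlower : ∀ x ∈ Set.Ioo (0 : ℝ) (Real.pi / 2), cosPow p x < Real.sin x / x := fun x hx =>
    (cosPow_lt_sin_div_forall_iff hroot hsmall ⟨hp0, hp1.le⟩).2 ⟨le_rfl, hp1.le⟩ x hx
  have hupper : ∀ x ∈ Set.Ioo (0 : ℝ) (Real.pi / 2), x ≠ y →
      Real.sin x / x < Real.exp (logDefect p y) * cosPow p x := fun x hx hxy => by
    rw [hfac x hx]
    exact mul_lt_mul_of_pos_right (Real.exp_lt_exp.2 (logDefect_lt_of_ne hp0 hsmall hy hx hxy))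
      (cosPow_pos (hcos x hx))
  have hle : ∀ x ∈ Set.Ioo (0 : ℝ) (Real.pi / 2),
      Real.sin x / x ≤ Real.exp (logDefect p y) * cosPow p x := fun x hx => by
    rcases eq_or_ne x y with rfl | hxy
    · exact (hfac x hx).le
    · exact (hupper x hx hxy).le
  refine ⟨p, y, Real.exp (logDefect p y), ⟨hroot, fun q hq => hroot.unique hq⟩, ⟨hp, hp'⟩,
    fun q hq => cosPow_lt_sin_div_forall_iff hroot hsmall hq,
    ⟨hy, fun z hz => hy.unique hp0 hsmall hz⟩, rfl, abs_exp_logDefect_sub_lt hp hp' hsmall hy,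
    fun x hx => ⟨hlower x hx, hle x hx, fun h => ?_, ?_⟩, ⟨fun x hx => ?_, fun a ha => ?_⟩,
    ⟨hle, fun b hb => ?_⟩⟩
  · by_contra hxy
    exact (hupper x hx hxy).ne h
  · rintro rfl
    exact hfac x hx
  · rw [one_mul]
    exact hlower x hx
  · exact le_one_of_mul_cosPow_lt hp0 hp1.le ha
  · have h := hb y hy.1
    rw [hfac y hy.1] at h
    exact le_of_mul_le_mul_right h (cosPow_pos (hcos y hy.1))
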